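/- Let $n\ge 0$ and let $\lambda=(\lambda_1,\dots,\lambda_n)\in\mathbb C^n$. Let $\mathfrak{gl}_n$ be the Lie algebra of complex $n\times n$ matrices, with matrix units $E_{ij}$, and let $L(\lambda)$ be the simple highest weight $\mathfrak{gl}_n$-module of highest weight $\lambda$, i.e. the simple module generated by a vector $v\ne 0$ with $E_{ij}v=0$ for $i<j$ and $E_{ii}v=\lambda_i v$ for all $i$. Let $\mathsf E$ be the $n\times n$ matrix over $\operatorname{End}_{\mathbb C}L(\lambda)$ whose $(i,j)$ entry is the operator by which $E_{ij}$ acts on $L(\lambda)$. Define the shuffle decomposition of a finite sequence of complex numbers, a collection of subsequences called its parts, recursively. The empty sequence has no parts. If the shuffle decomposition of $(l_1,\dots,l_{m-1})$ has been constructed, then that of $(l_1,\dots,l_m)$ is obtained by appending $l_m$ to the end of a longest part whose last term is $l_m+1$, leaving the other parts intact; if there is no part with last term $l_m+1$, a new part consisting of the single term $l_m$ is added. (Every part is an arithmetic progression with step $-1$, so longest parts with the same last term coincide as sequences and the choice among them does not matter.) Let $l=(l_1,\dots,l_n)$ with $l_i=\lambda_i+n-i$, and let $A$ be the multiset of the last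 terms of the parts of the shuffle decomposition of $l$. Then $\mathsf E$ is annihilated by some nonzero polynomial in $\mathbb C[u]$, and the multiset of roots, counted with multiplicity, of its minimal polynomial (the monic polynomial $q\in\mathbb C[u]$ of least degree with $q(\mathsf E)=0$) is exactly $A$. -/

import Mathlib

attribute [local instance 100] LieRing.ofAssociativeRing

/-- One step of the greedy algorithm: given the list `P` of parts built so far and the next
term `x`, append `x` to a longest part whose last term is `x + 1`; if there is no such part,
open the new part `[x]`. (Two longest parts with the same last term are built by steps of `-1`
and hence are equal as sequences, so it does not matter which of them is chosen.) -/
def shuffleStep {R : Type*} [DecidableEq R] [Add R] [One R]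
    (P : List (List R)) (x : R) : List (List R) :=
  match (P.filter (fun S => S.getLast? = some (x + 1))).argmax List.length with
  | none => [x] :: P
  | some S => (S ++ [x]) :: P.erase S

/-- The list of parts of the shuffle decomposition of a sequence `l`, read from left to right. -/
def shuffleParts {R : Type*} [DecidableEq R] [Add R] [One R] (l : List R) : List (List R) :=
  l.foldl shuffleStep []

/-- The multiset of the last terms of the parts of the shuffle decomposition of `l`
(every part is nonempty, so every part contributes exactly one term). -/
def shuffleLastTerms {R : Type*} [DecidableEq R] [Add R] [One R] (l : List R) : Multiset R :=
  ((shuffleParts l).filterMap List.getLast? : List R)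

/-- The Lie algebra `gl_n(ℂ)` of complex `n × n` matrices with the commutator bracket. -/
abbrev GlC (n : ℕ) : Type := Matrix (Fin n) (Fin n) ℂ

/-- `v` is a highest weight vector of weight `wt` with respect to the upper triangular Borel
subalgebra of `gl_n`: it is nonzero, it is killed by the matrix units `E_ij` with `i < j`, and
`E_ii v = wt_i v`. -/
structure IsHighestWeightVector {n : ℕ} {V : Type*} [AddCommGroup V] [Module ℂ V]
    [LieRingModule (GlC n) V] (wt : Fin n → ℂ) (v : V) : Prop where
  ne_zero : v ≠ 0
  raising : ∀ i j : Fin n, i < j → ⁅(Matrix.single i j 1 : GlC n), v⁆ = 0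
  weight : ∀ i : Fin n, ⁅(Matrix.single i i 1 : GlC n), v⁆ = wt i • v

/-- `V` is a simple `gl_n`-module generated by a highest weight vector of weight `wt`. -/
structure IsSimpleHighestWeightModule {n : ℕ} (wt : Fin n → ℂ) (V : Type*) [AddCommGroup V]
    [Module ℂ V] [LieRingModule (GlC n) V] [LieModule ℂ (GlC n) V] : Prop where
  irreducible : LieModule.IsIrreducible ℂ (GlC n) V
  generated : ∃ v : V, IsHighestWeightVector wt v ∧ LieSubmodule.lieSpan ℂ (GlC n) {v} = ⊤

/-- The matrix `E` over `U(gl_n)` whose `(i, j)` entry is the generator `E_ij`. -/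
noncomputable def generatorMatrix (n : ℕ) :
    Matrix (Fin n) (Fin n) (UniversalEnvelopingAlgebra ℂ (GlC n)) :=
  Matrix.of fun i j => UniversalEnvelopingAlgebra.ι ℂ (Matrix.single i j 1 : GlC n)

/-- The image of `E` in the `n × n` matrices over `End V` under `U(gl_n) → End V`. -/
noncomputable def generatorMatrixOn (n : ℕ) (V : Type*) [AddCommGroup V] [Module ℂ V]
    [LieRingModule (GlC n) V] [LieModule ℂ (GlC n) V] :
    Matrix (Fin n) (Fin n) (Module.End ℂ V) :=
  (generatorMatrix n).map
    (UniversalEnvelopingAlgebra.lift ℂ (LieModule.toEnd ℂ (GlC n) V))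

/-- The sequence `l = wt + ρ`, where `ρ = (n - 1, n - 2, …, 0)`. -/
noncomputable def shiftedWeight {n : ℕ} (wt : Fin n → ℂ) : List ℂ :=
  List.ofFn fun i : Fin n => wt i + ((n : ℂ) - 1 - ((i : ℕ) : ℂ))

open Polynomial

/-! ### Recursion for the last terms of the parts -/

section Combinatorics

/-! For a polynomial `p`, the entries of `p(E)` transform under `gl_n` like matrix units. On the
highest weight vector `v` the entries above the diagonal vanish, and the diagonal ones act by the
coordinates of `p(T)𝟙`, where `T` is an explicit upper triangular matrix with diagonal `l` and `𝟙`
is the all-ones vector (`aeval_generatorMatrixOn_apply`).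

If these scalars vanish, the vectors `p(E)_ij v` generate a submodule lying strictly below `v`; by
simplicity it is zero, and then `p(E) = 0` (`IsTensorMatrix.eq_zero_of_diag`). So the minimal
polynomial of `E` is the monic generator of the annihilator of `𝟙` under `T`. Induction on `n` shows
that this generator changes by the same rule as the last terms in the shuffle algorithm
(`aeval_triangularEnd_one_eq_zero_iff`). -/

theorem shuffleLastTerms_nil {R : Type*} [DecidableEq R] [Add R] [One R] :
    shuffleLastTerms ([] : List R) = 0 := rfl

/-- The lengths of parts disappear: whichever part is extended, one last term `x + 1` becomes `x`.
When `x + 1` is absent, `erase` does nothing, which is the case of a new part. -/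
theorem shuffleLastTerms_append_singleton {R : Type*} [DecidableEq R] [Add R] [One R]
    (l : List R) (x : R) :
    shuffleLastTerms (l ++ [x]) = x ::ₘ (shuffleLastTerms l).erase (x + 1) := by
  unfold shuffleLastTerms shuffleParts
  rw [List.foldl_append, List.foldl_cons, List.foldl_nil]
  generalize List.foldl shuffleStep [] l = P
  unfold shuffleStep
  split
  · rename_i h
    rw [List.argmax_eq_none] at h
    have hx : x + 1 ∉ ((P.filterMap List.getLast? : List R) : Multiset R) := by
      simp only [Multiset.mem_coe, List.mem_filterMap, not_exists, not_and]
      intro S hS hl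
      have : S ∈ P.filter (fun S => S.getLast? = some (x + 1)) := by simp [hS, hl]
      simp [h] at this
    rw [Multiset.erase_of_notMem hx]
    simp
  · rename_i S h
    have hS := List.argmax_mem h
    simp only [List.mem_filter, decide_eq_true_eq] at hS
    have hp := (List.perm_cons_erase hS.1).filterMap List.getLast?
    rw [List.filterMap_cons_some hS.2] at hp
    rw [Multiset.coe_eq_coe.2 hp, List.filterMap_cons_some (b := x) (by simp),
      ← Multiset.cons_coe, ← Multiset.cons_coe, Multiset.erase_cons_head]

end Combinatorics

/-! ### The annihilator of the all-ones vector -/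

section LinearAlgebra

/-- The upper triangular operator with diagonal `l` and all entries above the diagonal `-1`. -/
def triangularEnd {n : ℕ} (l : Fin n → ℂ) : Module.End ℂ (Fin n → ℂ) where
  toFun c k := l k * c k - ∑ a, if k < a then c a else 0
  map_add' c d := by
    ext k
    simp only [Pi.add_apply, ite_add_zero, Finset.sum_add_distrib]
    ring
  map_smul' r c := by
    ext k
    simp only [Pi.smul_apply, smul_eq_mul, RingHom.id_apply, mul_sub, Finset.mul_sum, mul_ite,
      mul_zero]
    ring

theorem triangularEnd_apply {n : ℕ} (l c : Fin n → ℂ) (k : Fin n) :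
    triangularEnd l c k = l k * c k - ∑ a, if k < a then c a else 0 := rfl

/-- Extension of a vector by a last coordinate `0`. -/
def snocZero (n : ℕ) : (Fin n → ℂ) →ₗ[ℂ] (Fin (n + 1) → ℂ) where
  toFun c := Fin.snoc c 0
  map_add' c d := by
    ext k
    refine Fin.lastCases ?_ (fun k => ?_) k <;> simp
  map_smul' r c := by
    ext k
    refine Fin.lastCases ?_ (fun k => ?_) k <;> simp

@[simp] theorem snocZero_last {n : ℕ} (c : Fin n → ℂ) : snocZero n c (Fin.last n) = 0 := by
  simp [snocZero]

@[simp] theorem snocZero_castSucc {n : ℕ} (c : Fin n → ℂ) (k : Fin n) :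
    snocZero n c k.castSucc = c k := by
  simp [snocZero]

theorem triangularEnd_snocZero {n : ℕ} (l : Fin (n + 1) → ℂ) (c : Fin n → ℂ) :
    triangularEnd l (snocZero n c) =
      snocZero n (triangularEnd (fun i => l i.castSucc) c) := by
  ext k
  rw [triangularEnd_apply, Fin.sum_univ_castSucc]
  refine Fin.lastCases ?_ (fun k => ?_) k
  · simp [Fin.not_lt.2 (Fin.le_last _)]
  · simp [triangularEnd_apply]

theorem aeval_triangularEnd_snocZero {n : ℕ} (l : Fin (n + 1) → ℂ) (p : ℂ[X])
    (c : Fin n → ℂ) :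
    aeval (triangularEnd l) p (snocZero n c) =
      snocZero n (aeval (triangularEnd fun i => l i.castSucc) p c) := by
  induction p using Polynomial.induction_on' generalizing c with
  | add p q hp hq => simp [hp, hq]
  | monomial m a =>
    induction m generalizing a c with
    | zero => simp [Module.algebraMap_end_apply]
    | succ m ih =>
      rw [← monomial_mul_X, map_mul, map_mul, aeval_X, aeval_X, Module.End.mul_apply,
        Module.End.mul_apply, triangularEnd_snocZero, ih]

/-- Passing to the first `n` coordinates moves the root `l_n` to `l_n + 1`, because the last column
contributes `-1` to every earlier row. This shift is the source of the `x + 1` in the algorithm. -/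
theorem triangularEnd_one {n : ℕ} (l : Fin (n + 1) → ℂ) :
    triangularEnd l 1 - l (Fin.last n) • (1 : Fin (n + 1) → ℂ) =
      snocZero n (triangularEnd (fun i => l i.castSucc) 1 -
        (l (Fin.last n) + 1) • (1 : Fin n → ℂ)) := by
  ext k
  rw [Pi.sub_apply, triangularEnd_apply, Fin.sum_univ_castSucc]
  refine Fin.lastCases ?_ (fun k => ?_) k
  · simp [Fin.not_lt.2 (Fin.le_last _)]
  · simp [triangularEnd_apply, Fin.castSucc_lt_last]
    ring

theorem aeval_triangularEnd_one {n : ℕ} (l : Fin (n + 1) → ℂ) (r : ℂ[X]) (b : ℂ) :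
    aeval (triangularEnd l) (r * (X - C (l (Fin.last n))) + C b) (1 : Fin (n + 1) → ℂ) =
      snocZero n (aeval (triangularEnd fun i => l i.castSucc)
        (r * (X - C (l (Fin.last n) + 1))) 1) + b • (1 : Fin (n + 1) → ℂ) := by
  have h := triangularEnd_one l
  simp only [map_add, map_mul, map_sub, aeval_X, aeval_C, Module.End.mul_apply,
    LinearMap.add_apply, LinearMap.sub_apply, Module.algebraMap_end_apply] at h ⊢
  rw [← map_sub, h, ← map_sub, aeval_triangularEnd_snocZero, map_sub]
  simp only [add_smul, one_smul, map_add, map_sub]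

theorem aeval_triangularEnd_one_eq_zero_iff {n : ℕ} (l : Fin n → ℂ) (p : ℂ[X]) :
    aeval (triangularEnd l) p (1 : Fin n → ℂ) = 0 ↔
      ((shuffleLastTerms (List.ofFn l)).map fun a => X - C a).prod ∣ p := by
  induction n generalizing p with
  | zero => simp [shuffleLastTerms_nil, eq_iff_true_of_subsingleton]
  | succ n ih =>
    set x := l (Fin.last n) with hx
    rw [List.ofFn_succ', List.concat_eq_append, shuffleLastTerms_append_singleton, ← hx]
    set A := shuffleLastTerms (List.ofFn fun i : Fin n => l i.castSucc) with hA
    rw [Multiset.map_cons, Multiset.prod_cons]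
    -- If `x + 1` lies in `A`, cancel that factor once; otherwise it is coprime to the product over
    -- `A`.
    have key : ∀ r : ℂ[X], (A.map fun a => X - C a).prod ∣ r * (X - C (x + 1)) ↔
        ((A.erase (x + 1)).map fun a => X - C a).prod ∣ r := by
      intro r
      by_cases hm : x + 1 ∈ A
      · rw [← Multiset.prod_map_erase hm, mul_comm r]
        exact mul_dvd_mul_iff_left (X_sub_C_ne_zero _)
      · rw [Multiset.erase_of_notMem hm]
        refine ⟨fun h => IsCoprime.dvd_of_dvd_mul_right ?_ h, fun h => h.mul_right _⟩
        refine Multiset.prod_induction (fun q => IsCoprime q (X - C (x + 1))) _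
          (fun _ _ => IsCoprime.mul_left) isCoprime_one_left fun q hq => ?_
        obtain ⟨a, ha, rfl⟩ := Multiset.mem_map.1 hq
        refine isCoprime_X_sub_C_of_isUnit_sub (sub_ne_zero.2 ?_).isUnit
        rintro rfl
        exact hm ha
    -- The remainder `b` is the last coordinate of `p(T)𝟙`, so both sides of the equivalence force
    -- `b = 0`.
    obtain ⟨r, b, rfl⟩ : ∃ (r : ℂ[X]) (b : ℂ), p = r * (X - C x) + C b :=
      ⟨p /ₘ (X - C x), p.eval x, by
        rw [← modByMonic_X_sub_C_eq_C_eval, mul_comm, add_comm, modByMonic_add_div]⟩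
    have hb : ∀ q : ℂ[X], (X - C x) * q ∣ r * (X - C x) + C b → b = 0 := by
      intro q h
      have := (dvd_iff_isRoot.1 ((dvd_mul_right _ _).trans h))
      simpa using this
    rw [aeval_triangularEnd_one]
    constructor
    · intro h
      have hb0 : b = 0 := by simpa using congrFun h (Fin.last n)
      subst hb0
      have h' : aeval (triangularEnd fun i => l i.castSucc) (r * (X - C (x + 1))) 1 = 0 := by
        ext k
        simpa using congrFun h k.castSucc
      rw [ih, key] at h'
      rw [C_0, add_zero, mul_comm]
      exact mul_dvd_mul_right h' _
    · intro h
      obtain rfl := hb _ h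
      rw [C_0, add_zero, mul_comm r, mul_dvd_mul_iff_left (X_sub_C_ne_zero _), ← key, ← ih] at h
      rw [h]
      simp

end LinearAlgebra

/-! ### Polynomials in `E` on the highest weight vector -/

section Representation

set_option linter.unusedSectionVars false

variable {n : ℕ} {V : Type*} [AddCommGroup V] [Module ℂ V]
  [LieRingModule (GlC n) V] [LieModule ℂ (GlC n) V]

theorem generatorMatrixOn_apply (i j : Fin n) (w : V) :
    generatorMatrixOn n V i j w = ⁅(Matrix.single i j 1 : GlC n), w⁆ := by
  simp [generatorMatrixOn, generatorMatrix]

theorem lie_single_single (a b i j : Fin n) :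
    ⁅(Matrix.single a b 1 : GlC n), (Matrix.single i j 1 : GlC n)⁆ =
      (if b = i then Matrix.single a j 1 else 0) - (if a = j then Matrix.single i b 1 else 0) := by
  rw [Ring.lie_def]
  congr 1
  · split_ifs with h
    · subst h; simp
    · simp [h]
  · split_ifs with h
    · subst h; simp
    · simp [Ne.symm h]

/-- The matrices over `End V` whose entries transform under `gl_n` like the matrix units. -/
def IsTensorMatrix (M : Matrix (Fin n) (Fin n) (Module.End ℂ V)) : Prop :=
  ∀ (a b i j : Fin n) (w : V), ⁅(Matrix.single a b 1 : GlC n), M i j w⁆ =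
    M i j ⁅(Matrix.single a b 1 : GlC n), w⁆ +
      ((if b = i then M a j w else 0) - (if a = j then M i b w else 0))

theorem isTensorMatrix_generatorMatrixOn : IsTensorMatrix (generatorMatrixOn n V) := by
  intro a b i j w
  simp only [generatorMatrixOn_apply]
  rw [leibniz_lie, lie_single_single, sub_lie, add_comm]
  congr 2 <;> split_ifs <;> simp

theorem isTensorMatrix_one :
    IsTensorMatrix (1 : Matrix (Fin n) (Fin n) (Module.End ℂ V)) := by
  intro a b i j w
  by_cases hbi : b = i <;> by_cases haj : a = j <;> simp only [Matrix.one_apply, hbi, haj, if_true, if_false]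
  · split_ifs <;> simp
  · split_ifs <;> simp
  · split_ifs <;> simp_all
  · split_ifs <;> simp

theorem IsTensorMatrix.add {M N : Matrix (Fin n) (Fin n) (Module.End ℂ V)}
    (hM : IsTensorMatrix M) (hN : IsTensorMatrix N) : IsTensorMatrix (M + N) := by
  intro a b i j w
  simp only [Matrix.add_apply, LinearMap.add_apply, lie_add, hM a b i j w, hN a b i j w]
  split_ifs <;> abel

theorem IsTensorMatrix.smul {M : Matrix (Fin n) (Fin n) (Module.End ℂ V)}
    (hM : IsTensorMatrix M) (r : ℂ) : IsTensorMatrix (r • M) := by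
  intro a b i j w
  simp only [Matrix.smul_apply, LinearMap.smul_apply, lie_smul, hM a b i j w]
  split_ifs <;> simp [smul_add, smul_sub]

theorem IsTensorMatrix.mul {M N : Matrix (Fin n) (Fin n) (Module.End ℂ V)}
    (hM : IsTensorMatrix M) (hN : IsTensorMatrix N) : IsTensorMatrix (M * N) := by
  intro a b i j w
  have hite : ∀ (k : Fin n) (P : Prop) [Decidable P] (x : V),
      M i k (if P then x else 0) = if P then M i k x else 0 := fun k P _ x => by
    split_ifs <;> simp
  have hsum : ∀ (P : Prop) [Decidable P] (f : Fin n → V),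
      (∑ k, if P then f k else 0) = if P then ∑ k, f k else 0 := fun P _ f => by
    split_ifs <;> simp
  simp only [Matrix.mul_apply, LinearMap.sum_apply, Module.End.mul_apply, lie_sum,
    hM a b, hN a b, map_add, map_sub, Finset.sum_add_distrib, Finset.sum_sub_distrib,
    hite, hsum, Finset.sum_ite_eq, Finset.mem_univ, if_true]
  split_ifs <;> abel

theorem isTensorMatrix_aeval (p : ℂ[X]) :
    IsTensorMatrix (aeval (generatorMatrixOn n V) p) := by
  induction p using Polynomial.induction_on with
  | C a =>
    rw [aeval_C, Algebra.algebraMap_eq_smul_one]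
    exact isTensorMatrix_one.smul a
  | add p q hp hq => rw [map_add]; exact hp.add hq
  | monomial m a h =>
    rw [pow_succ, ← mul_assoc, map_mul, aeval_X]
    exact h.mul isTensorMatrix_generatorMatrixOn

theorem IsTensorMatrix.mul_generatorMatrixOn_apply
    {M : Matrix (Fin n) (Fin n) (Module.End ℂ V)} (hM : IsTensorMatrix M)
    {wt : Fin n → ℂ} {v : V} (hv : IsHighestWeightVector wt v)
    (hup : ∀ i j, i < j → M i j v = 0) {i j : Fin n} (hij : i ≤ j) :
    (M * generatorMatrixOn n V) i j v =
      wt j • M i j v + ∑ a, if j < a then M i j v - (if i = j then M a a v else 0) else 0 := by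
  have hterm : ∀ a, M i a (generatorMatrixOn n V a j v) =
      (if j = a then wt j • M i j v else 0) +
        if j < a then M i j v - (if i = j then M a a v else 0) else 0 := by
    intro a
    rw [generatorMatrixOn_apply]
    rcases lt_trichotomy a j with h | rfl | h
    · rw [hv.raising a j h]
      simp [h.ne', h.not_gt]
    · rw [hv.weight]
      simp
    -- Here `i ≤ j < a`, so `M i a v = 0` and the commutation rule alone determines `M i a (E_aj
    -- v)`.
    · have := hM a j i a v
      rw [hup i a (hij.trans_lt h), lie_zero] at this
      simp only [if_true, eq_comm (a := j) (b := i)] at this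
      simp only [h, h.ne, if_true, if_false, zero_add]
      rw [eq_neg_of_add_eq_zero_left this.symm, neg_sub]
  simp only [Matrix.mul_apply, LinearMap.sum_apply, Module.End.mul_apply, hterm,
    Finset.sum_add_distrib, Finset.sum_ite_eq, Finset.mem_univ, if_true]

theorem card_gt_eq (k : Fin n) :
    (∑ a : Fin n, if k < a then (1 : ℂ) else 0) = (n : ℂ) - 1 - ((k : ℕ) : ℂ) := by
  rw [Finset.sum_boole, Finset.filter_lt_eq_Ioi, Fin.card_Ioi, Nat.sub_sub,
    Nat.cast_sub (by omega)]
  push_cast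
  ring

theorem aeval_generatorMatrixOn_apply {wt : Fin n → ℂ} {v : V}
    (hv : IsHighestWeightVector wt v) (p : ℂ[X]) :
    (∀ i j, i < j → aeval (generatorMatrixOn n V) p i j v = 0) ∧
      ∀ i, aeval (generatorMatrixOn n V) p i i v =
        aeval (triangularEnd fun i : Fin n => wt i + ((n : ℂ) - 1 - ((i : ℕ) : ℂ))) p
          (1 : Fin n → ℂ) i • v := by
  induction p using Polynomial.induction_on with
  | C a =>
    refine ⟨fun i j h => ?_, fun i => ?_⟩
    · simp [Algebra.algebraMap_eq_smul_one, h.ne]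
    · simp [Algebra.algebraMap_eq_smul_one]
  | add p q hp hq =>
    refine ⟨fun i j h => ?_, fun i => ?_⟩
    · simp [hp.1 i j h, hq.1 i j h]
    · simp [hp.2 i, hq.2 i, add_smul]
  | monomial m a h =>
    rw [pow_succ, ← mul_assoc]
    generalize C a * X ^ m = p at h
    have hp := isTensorMatrix_aeval (n := n) (V := V) p
    rw [map_mul, aeval_X]
    refine ⟨fun i j hij => ?_, fun i => ?_⟩
    · rw [hp.mul_generatorMatrixOn_apply hv h.1 hij.le, h.1 i j hij]
      simp [hij.ne]
    -- The `ρ`-shift in `l_i` counts the indices `a > i`, each contributing one copy of `M i i v`.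
    · rw [hp.mul_generatorMatrixOn_apply hv h.1 le_rfl, mul_comm p, map_mul, aeval_X,
        Module.End.mul_apply, triangularEnd_apply, ← card_gt_eq i]
      simp only [h.2, if_true]
      generalize aeval (triangularEnd _) p (1 : Fin n → ℂ) = c
      rw [smul_smul, add_mul, Finset.sum_mul, add_sub_assoc, ← Finset.sum_sub_distrib, add_smul,
        Finset.sum_smul]
      congr 1
      refine Finset.sum_congr rfl fun b _ => ?_
      split_ifs <;> simp [sub_smul]

/-! ### Height grading and the use of simplicity -/

/-- The diagonal matrix with entries `0, 1, …, n - 1`, which grades `gl_n` by height. -/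
def heightElement (n : ℕ) : GlC n := ∑ i : Fin n, ((i : ℕ) : ℂ) • Matrix.single i i 1

theorem lie_heightElement_single (i j : Fin n) :
    ⁅heightElement n, (Matrix.single i j 1 : GlC n)⁆ =
      (((i : ℕ) : ℂ) - ((j : ℕ) : ℂ)) • (Matrix.single i j 1 : GlC n) := by
  simp only [heightElement, sum_lie, smul_lie, lie_single_single, smul_sub,
    Finset.sum_sub_distrib, smul_ite, smul_zero, Finset.sum_ite_eq', Finset.mem_univ, if_true,
    sub_smul]

theorem IsHighestWeightVector.lie_heightElement {wt : Fin n → ℂ} {v : V}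
    (hv : IsHighestWeightVector wt v) :
    ⁅heightElement n, v⁆ = (∑ i : Fin n, ((i : ℕ) : ℂ) * wt i) • v := by
  simp only [heightElement, sum_lie, smul_lie, hv.weight, smul_smul, Finset.sum_smul]

theorem IsTensorMatrix.lie_heightElement {M : Matrix (Fin n) (Fin n) (Module.End ℂ V)}
    (hM : IsTensorMatrix M) (i j : Fin n) (w : V) :
    ⁅heightElement n, M i j w⁆ =
      M i j ⁅heightElement n, w⁆ + (((i : ℕ) : ℂ) - ((j : ℕ) : ℂ)) • M i j w := by
  simp only [heightElement, sum_lie, smul_lie, hM _ _ i j w, smul_add, smul_sub,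
    Finset.sum_add_distrib, Finset.sum_sub_distrib, smul_ite, smul_zero, Finset.sum_ite_eq',
    Finset.mem_univ, if_true, sub_smul, map_sum, map_smul]

theorem lie_mem_of_forall_single {N : Submodule ℂ V} {w : V}
    (h : ∀ i j : Fin n, ⁅(Matrix.single i j 1 : GlC n), w⁆ ∈ N) (x : GlC n) : ⁅x, w⁆ ∈ N := by
  rw [Matrix.matrix_eq_sum_single x]
  simp only [sum_lie]
  refine Submodule.sum_mem _ fun i _ => Submodule.sum_mem _ fun j _ => ?_
  rw [← mul_one (x i j), ← smul_eq_mul, ← Matrix.smul_single, smul_lie]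
  exact N.smul_mem _ (h i j)

/-- The smallest subspace that contains `S` and is stable under the lowering operators. -/
def loweringSpan (n : ℕ) {V : Type*} [AddCommGroup V] [Module ℂ V]
    [LieRingModule (GlC n) V] (S : Submodule ℂ V) : Submodule ℂ V :=
  sInf {N | S ≤ N ∧ ∀ i j : Fin n, j < i → ∀ w ∈ N, ⁅(Matrix.single i j 1 : GlC n), w⁆ ∈ N}

theorem loweringSpan_le {S N : Submodule ℂ V} (hS : S ≤ N)
    (h : ∀ i j : Fin n, j < i → ∀ w ∈ N, ⁅(Matrix.single i j 1 : GlC n), w⁆ ∈ N) :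
    loweringSpan n S ≤ N :=
  sInf_le ⟨hS, h⟩

theorem le_loweringSpan (S : Submodule ℂ V) : S ≤ loweringSpan n S :=
  le_sInf fun _ h => h.1

theorem lie_mem_loweringSpan {S : Submodule ℂ V} {i j : Fin n} (hij : j < i) {w : V}
    (hw : w ∈ loweringSpan n S) : ⁅(Matrix.single i j 1 : GlC n), w⁆ ∈ loweringSpan n S := by
  simp only [loweringSpan, Submodule.mem_sInf] at hw ⊢
  exact fun N hN => hN.2 i j hij w (hw N hN)

/-- A substitute for PBW: the vectors that all of `gl_n` keeps in the lowering span include `S` and,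
by the Leibniz rule, are stable under lowering. -/
theorem lie_mem_loweringSpan_of_borel {S : Submodule ℂ V}
    (hS : ∀ i j : Fin n, i ≤ j → ∀ w ∈ S, ⁅(Matrix.single i j 1 : GlC n), w⁆ ∈ S)
    (x : GlC n) {w : V} (hw : w ∈ loweringSpan n S) : ⁅x, w⁆ ∈ loweringSpan n S := by
  let N : Submodule ℂ V :=
    { carrier := {w | w ∈ loweringSpan n S ∧ ∀ x : GlC n, ⁅x, w⁆ ∈ loweringSpan n S}
      add_mem' := fun ha hb => ⟨add_mem ha.1 hb.1, fun x => by
        rw [lie_add]; exact add_mem (ha.2 x) (hb.2 x)⟩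
      zero_mem' := ⟨zero_mem _, fun x => by simp⟩
      smul_mem' := fun r a ha => ⟨Submodule.smul_mem _ r ha.1, fun x => by
        rw [lie_smul]; exact Submodule.smul_mem _ r (ha.2 x)⟩ }
  have hN : loweringSpan n S ≤ N := by
    refine loweringSpan_le (fun w hw => ⟨le_loweringSpan S hw, ?_⟩)
      (fun i j hij w hw => ⟨lie_mem_loweringSpan hij hw.1, fun x => ?_⟩)
    · refine lie_mem_of_forall_single fun i j => ?_
      rcases le_or_gt i j with h | h
      · exact le_loweringSpan S (hS i j h w hw)
      · exact lie_mem_loweringSpan h (le_loweringSpan S hw)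
    · rw [leibniz_lie]
      exact add_mem (hw.2 _) (lie_mem_loweringSpan hij (hw.2 x))
  exact (hN hw).2 x

/-- The sum of the eigenspaces of the height element with eigenvalues `μ + 1, μ + 2, …`. -/
def positiveHeight (n : ℕ) (V : Type*) [AddCommGroup V] [Module ℂ V]
    [LieRingModule (GlC n) V] [LieModule ℂ (GlC n) V] (μ : ℂ) : Submodule ℂ V :=
  ⨆ m : ℕ, (LieModule.toEnd ℂ (GlC n) V (heightElement n)).eigenspace (μ + (m + 1 : ℕ))

theorem mem_positiveHeight {μ : ℂ} {w : V} {m : ℕ} (hm : 0 < m)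
    (hw : ⁅heightElement n, w⁆ = (μ + m) • w) : w ∈ positiveHeight n V μ := by
  obtain ⟨m, rfl⟩ := Nat.exists_eq_add_one.2 hm
  exact Submodule.mem_iSup_of_mem m (Module.End.mem_eigenspace_iff.2 hw)

theorem lie_mem_positiveHeight {μ : ℂ} {i j : Fin n} (hij : j < i) {w : V}
    (hw : w ∈ positiveHeight n V μ) :
    ⁅(Matrix.single i j 1 : GlC n), w⁆ ∈ positiveHeight n V μ := by
  induction hw using Submodule.iSup_induction' with
  | mem m w hw =>
    rw [Module.End.mem_eigenspace_iff, LieModule.toEnd_apply_apply] at hw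
    refine mem_positiveHeight (m := m + 1 + ((i : ℕ) - (j : ℕ))) (by omega) ?_
    rw [leibniz_lie, lie_heightElement_single, hw, lie_smul, smul_lie, ← add_smul]
    congr 1
    rw [Nat.cast_add (m + 1), Nat.cast_sub (show (j : ℕ) ≤ i from hij.le)]
    ring
  | zero => simp
  | add x y _ _ hx hy => rw [lie_add]; exact add_mem hx hy

theorem eq_zero_of_mem_positiveHeight {μ : ℂ} {w : V} (hw : w ∈ positiveHeight n V μ)
    (h : ⁅heightElement n, w⁆ = μ • w) : w = 0 := by
  have hd := (Module.End.eigenspaces_iSupIndep (LieModule.toEnd ℂ (GlC n) V (heightElement n))) μ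
  refine Submodule.disjoint_def.1 hd w (Module.End.mem_eigenspace_iff.2 h) ?_
  refine (iSup_le fun m => ?_ : positiveHeight n V μ ≤ _) hw
  refine le_iSup₂_of_le (μ + (m + 1 : ℕ)) ?_ le_rfl
  rw [Ne, add_eq_left]
  exact Nat.cast_ne_zero.2 m.succ_ne_zero

/-- By equivariance, the common kernel of the entries is a submodule, and it contains the generator.
-/
theorem IsTensorMatrix.eq_zero_of_apply_highestWeightVector
    {M : Matrix (Fin n) (Fin n) (Module.End ℂ V)} (hM : IsTensorMatrix M) {v : V}
    (hgen : LieSubmodule.lieSpan ℂ (GlC n) {v} = ⊤) (h : ∀ i j, M i j v = 0) : M = 0 := by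
  let N : Submodule ℂ V := ⨅ i, ⨅ j, LinearMap.ker (M i j)
  have hN : ∀ w, w ∈ N ↔ ∀ i j, M i j w = 0 := by simp [N]
  let K : LieSubmodule ℂ (GlC n) V :=
    { N with
      lie_mem := by
        intro x w hw
        refine lie_mem_of_forall_single (N := N) (fun a b => (hN _).2 fun i j => ?_) x
        have hw' := (hN w).1 hw
        simpa [hw'] using (hM a b i j w).symm }
  have hK : K = ⊤ := by
    rw [eq_top_iff, ← hgen, LieSubmodule.lieSpan_le, Set.singleton_subset_iff]
    exact (hN v).2 h
  ext i j w
  have : w ∈ K := hK ▸ LieSubmodule.mem_top w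
  simpa using (hN w).1 this i j

theorem IsTensorMatrix.eq_zero_of_diag {wt : Fin n → ℂ}
    {M : Matrix (Fin n) (Fin n) (Module.End ℂ V)} (hM : IsTensorMatrix M) {v : V}
    (hirr : LieModule.IsIrreducible ℂ (GlC n) V) (hv : IsHighestWeightVector wt v)
    (hgen : LieSubmodule.lieSpan ℂ (GlC n) {v} = ⊤)
    (hup : ∀ i j, i < j → M i j v = 0) (hdiag : ∀ i, M i i v = 0) : M = 0 := by
  refine hM.eq_zero_of_apply_highestWeightVector hgen ?_
  set S : Submodule ℂ V := Submodule.span ℂ (Set.range fun q : Fin n × Fin n => M q.1 q.2 v)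
    with hSdef
  have hmem : ∀ i j, M i j v ∈ S := fun i j => Submodule.subset_span ⟨(i, j), rfl⟩
  have hS : ∀ i j : Fin n, i ≤ j → ∀ w ∈ S, ⁅(Matrix.single i j 1 : GlC n), w⁆ ∈ S := by
    intro a b hab w hw
    induction hw using Submodule.span_induction with
    | mem w hw =>
      obtain ⟨⟨i, j⟩, rfl⟩ := hw
      rw [hM a b i j v]
      refine add_mem ?_ (sub_mem ?_ ?_)
      · rcases hab.lt_or_eq with h | rfl
        · rw [hv.raising a b h, map_zero]; exact zero_mem _
        · rw [hv.weight, map_smul]; exact S.smul_mem _ (hmem i j)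
      · split_ifs
        exacts [hmem _ _, zero_mem _]
      · split_ifs
        exacts [hmem _ _, zero_mem _]
    | zero => rw [lie_zero]; exact zero_mem _
    | add x y _ _ hx hy => rw [lie_add]; exact add_mem hx hy
    | smul r x _ hx => rw [lie_smul]; exact S.smul_mem r hx
  let K : LieSubmodule ℂ (GlC n) V :=
    { loweringSpan n S with lie_mem := fun hw => lie_mem_loweringSpan_of_borel hS _ hw }
  -- Only entries with `i > j` survive on `v`. They raise the height by `i - j > 0`, as do lowering
  -- operators, so `v` itself is never reached.
  have hpos : loweringSpan n S ≤ positiveHeight n V (∑ i : Fin n, ((i : ℕ) : ℂ) * wt i) := by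
    refine loweringSpan_le (Submodule.span_le.2 ?_)
      (fun i j hij w hw => lie_mem_positiveHeight hij hw)
    rintro _ ⟨⟨i, j⟩, rfl⟩
    change M i j v ∈ _
    rcases lt_trichotomy i j with h | rfl | h
    · rw [hup i j h]; exact zero_mem _
    · rw [hdiag]; exact zero_mem _
    · refine mem_positiveHeight (m := (i : ℕ) - (j : ℕ)) (Nat.sub_pos_of_lt h) ?_
      rw [hM.lie_heightElement, hv.lie_heightElement, map_smul, ← add_smul,
        Nat.cast_sub (show (j : ℕ) ≤ i from h.le)]
  rcases eq_bot_or_eq_top K with hK | hK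
  · intro i j
    have : M i j v ∈ K := le_loweringSpan S (hmem i j)
    rwa [hK, LieSubmodule.mem_bot] at this
  · have : v ∈ K := hK ▸ LieSubmodule.mem_top v
    exact absurd (eq_zero_of_mem_positiveHeight (hpos this) hv.lie_heightElement) hv.ne_zero

theorem aeval_generatorMatrixOn_eq_zero_iff {wt : Fin n → ℂ}
    (hV : IsSimpleHighestWeightModule wt V) (p : ℂ[X]) :
    aeval (generatorMatrixOn n V) p = 0 ↔
      ((shuffleLastTerms (shiftedWeight wt)).map fun a => X - C a).prod ∣ p := by
  obtain ⟨v, hv, hgen⟩ := hV.generated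
  obtain ⟨hup, hdiag⟩ := aeval_generatorMatrixOn_apply hv p
  rw [shiftedWeight, ← aeval_triangularEnd_one_eq_zero_iff]
  constructor
  · intro h
    ext i
    have := hdiag i
    rw [h, Matrix.zero_apply, LinearMap.zero_apply, eq_comm, smul_eq_zero] at this
    exact this.resolve_right hv.ne_zero
  · intro h
    refine (isTensorMatrix_aeval p).eq_zero_of_diag hV.irreducible hv hgen hup fun i => ?_
    rw [hdiag, h, Pi.zero_apply, zero_smul]

end Representation

theorem theorem4 (n : ℕ) (wt : Fin n → ℂ) (V : Type*) [AddCommGroup V] [Module ℂ V]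
    [LieRingModule (GlC n) V] [LieModule ℂ (GlC n) V]
    (hV : IsSimpleHighestWeightModule wt V) :
    IsIntegral ℂ (generatorMatrixOn n V) ∧
      (minpoly ℂ (generatorMatrixOn n V)).roots = shuffleLastTerms (shiftedWeight wt) := by
  have hmonic : ((shuffleLastTerms (shiftedWeight wt)).map fun a => X - C a).prod.Monic :=
    monic_multisetProd_X_sub_C _
  have hint : IsIntegral ℂ (generatorMatrixOn n V) :=
    ⟨_, hmonic, (aeval_generatorMatrixOn_eq_zero_iff hV _).2 dvd_rfl⟩
  refine ⟨hint, ?_⟩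
  have heq : minpoly ℂ (generatorMatrixOn n V) =
      ((shuffleLastTerms (shiftedWeight wt)).map fun a => X - C a).prod :=
    eq_of_monic_of_associated (minpoly.monic hint) hmonic (associated_of_dvd_dvd
      (minpoly.dvd _ _ ((aeval_generatorMatrixOn_eq_zero_iff hV _).2 dvd_rfl))
      ((aeval_generatorMatrixOn_eq_zero_iff hV _).1 (minpoly.aeval _ _)))
  rw [heq, roots_multiset_prod_X_sub_C]
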